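/- Let $(\Omega,\mathcal F)$ be a measurable space, let $E$ be a non-empty Borel space (a topological space homeomorphic to a Borel subset of a Polish space) with Borel $\sigma$-field $\mathcal E$, let $A\in\mathcal F\otimes\mathcal E$, and let $f:\Omega\times E\to[-\infty,\infty]$ be $\mathcal F\otimes\mathcal E$-measurable (for example real-valued). For a probability measure $\mathbb P$ on $(\Omega,\mathcal F)$ let $\mathcal F^{\mathbb P}$ be the $\sigma$-field generated by $\mathcal F$ and the sets of $\mathbb P$-outer measure zero, and let $\mathcal F^U=\bigcap_{\mathbb P}\mathcal F^{\mathbb P}$, over all probability measures $\mathbb P$ on $(\Omega,\mathcal F)$, be the universal completion of $\mathcal F$. Write $A^\omega=\{x\in E:(\omega,x)\in A\}$, $\pi_\Omega(A)=\{\omega: A^\omega\neq\emptyset\}$ and, for $\varepsilon>0$, $$g(\omega)=\sup\{f(\omega,x):(\omega,x)\in A\}\quad(\sup\emptyset=-\infty),\qquad g^\varepsilon(\omega)=\begin{cases} g(\omega)-\varepsilon, & g(\omega)<\infty,\\ 1/\varepsilon, & g(\omega)=\infty.\end{cases}$$ (i) The function $g:\Omega\to[-\infty,\infty]$ is $\mathcal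 F^U$-measurable and $\pi_\Omega(A)\in\mathcal F^U$. Moreover, for every $\varepsilon>0$ there is an $\mathcal F^U$-measurable map $Z_\varepsilon:\Omega\to E$ such that, for every $\omega\in\pi_\Omega(A)$, $$Z_\varepsilon(\omega)\in A^\omega\quad\text{and}\quad f(\omega,Z_\varepsilon(\omega))\ge g^\varepsilon(\omega).$$ (ii) For every probability measure $\mathbb P$ on $(\Omega,\mathcal F)$, $$\mathbb E^{\mathbb P}\big[g\,1_{\pi_\Omega(A)}\big]=\sup\Big\{\mathbb E^{\mathbb P}\big[f(\omega,Z(\omega))1_{\pi_\Omega(A)}(\omega)\big]\;:\;Z:\Omega\to E\ \ \mathcal F\text{-measurable},\ Z(\omega)\in A^\omega\text{ for }\mathbb P\text{-a.e. }\omega\in\pi_\Omega(A)\Big\}.$$ Here $\mathbb E^{\mathbb P}[X]=\mathbb E^{\mathbb P}[X^+]-\mathbb E^{\mathbb P}[X^-]\in[-\infty,\infty]$ with the convention $\infty-\infty=-\infty$, and the products with $1_{\pi_\Omega(A)}$ are $0$ outside $\pi_\Omega(A)$. -/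

import Mathlib

open MeasureTheory Set
open scoped ENNReal

universe u v

/-- A topological space is a Borel space if it is homeomorphic to a Borel subset of a Polish
space. -/
def IsBorelTopSpace (E : Type v) [TopologicalSpace E] : Prop :=
  ∃ (X : Type v) (_ : TopologicalSpace X) (_ : PolishSpace X) (s : Set X),
    MeasurableSet[borel X] s ∧ Nonempty (E ≃ₜ s)

section Completion

variable {Ω : Type u} [mΩ : MeasurableSpace Ω]

/-- The completion of the σ-field of `Ω` with respect to `P`: the sets that differ from a measurable
set by a `P`-negligible set. -/
abbrev completionField (P : Measure Ω) : MeasurableSpace Ω :=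
  eventuallyMeasurableSpace mΩ (ae P)

/-- The completion is the σ-field generated by the measurable sets and the sets of outer measure
zero (in Mathlib, `P N` is the outer measure of `N` when `N` is not measurable). -/
theorem completionField_eq_generateFrom (P : Measure Ω) :
    completionField P = MeasurableSpace.generateFrom ({s | MeasurableSet s} ∪ {N | P N = 0}) := by
  apply le_antisymm
  · rintro s ⟨t, ht, hst⟩
    have h1 : P (s \ t) = 0 := (ae_eq_set.1 hst).1
    have h2 : P (t \ s) = 0 := (ae_eq_set.1 hst).2
    have hs : s = (t \ (t \ s)) ∪ (s \ t) := by
      ext x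
      by_cases hx : x ∈ t <;> simp [hx]
    rw [hs]
    refine MeasurableSet.union (MeasurableSet.diff ?_ ?_) ?_
    · exact MeasurableSpace.measurableSet_generateFrom (Or.inl ht)
    · exact MeasurableSpace.measurableSet_generateFrom (Or.inr h2)
    · exact MeasurableSpace.measurableSet_generateFrom (Or.inr h1)
  · refine MeasurableSpace.generateFrom_le ?_
    rintro s (hs | hs)
    · exact ⟨s, hs, Filter.EventuallyEq.rfl⟩
    · exact ⟨∅, MeasurableSet.empty, ae_eq_empty.2 hs⟩

variable (mΩ) in
/-- The universal completion of a σ-field: the intersection of its completions with respect to all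
probability measures. -/
abbrev universalCompletion : MeasurableSpace Ω :=
  ⨅ (P : Measure Ω) (_ : IsProbabilityMeasure P), completionField P

theorem measurableSet_universalCompletion_iff {s : Set Ω} :
    MeasurableSet[universalCompletion mΩ] s ↔
      ∀ P : Measure Ω, IsProbabilityMeasure P → NullMeasurableSet s P := by
  unfold universalCompletion
  simp_rw [MeasurableSpace.measurableSet_iInf]
  rfl

end Completion

section Optimization

variable {Ω : Type u} {E : Type v}

/-- The projection `π_Ω(A)` of `A ⊆ Ω × E`. -/
def projΩ (A : Set (Ω × E)) : Set Ω := {ω | ∃ x : E, (ω, x) ∈ A}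

/-- The supremum function `g(ω) = sup {f(ω, x) : (ω, x) ∈ A}`; it is `-∞` when the section of `A`
at `ω` is empty. -/
noncomputable def supFun (A : Set (Ω × E)) (f : Ω × E → EReal) (ω : Ω) : EReal :=
  sSup {y | ∃ x : E, (ω, x) ∈ A ∧ f (ω, x) = y}

open Classical in
/-- The level `g^ε = (g - ε) 1_{g < ∞} + (1/ε) 1_{g = ∞}`. -/
noncomputable def supFunEps (A : Set (Ω × E)) (f : Ω × E → EReal) (ε : ℝ) (ω : Ω) : EReal :=
  if supFun A f ω = ⊤ then ((1 / ε : ℝ) : EReal) else supFun A f ω - (ε : EReal)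

/-- The expectation `E[X] = E[X⁺] - E[X⁻]` of an extended real random variable, with the convention
`∞ - ∞ = -∞` (which is the one of `EReal`). -/
noncomputable def extExpectation [MeasurableSpace Ω] (P : Measure Ω) (X : Ω → EReal) : EReal :=
  ((∫⁻ ω, (X ω).toENNReal ∂P : ℝ≥0∞) : EReal) - ((∫⁻ ω, (-X ω).toENNReal ∂P : ℝ≥0∞) : EReal)

end Optimization

/-!
A measurable set `A ⊆ Ω × E` depends on only countably many measurable subsets of `Ω`: it is the
preimage under `(ω, x) ↦ (φ ω, x)` of a Borel set `B ⊆ (ℕ → ℕ) × E`, for some measurable `φ`. So it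
is enough to project and to uniformize `B`, the image of the Baire space under a continuous `h`. A
finite measure of an analytic set is approximated on the compact sets of sequences bounded by a
fixed one, which makes analytic sets universally measurable. Each cylinder has an analytic image
under `u = Prod.fst ∘ h`, and a measurable choice of successive cylinders whose images contain `y`
converges to some `a y` with `u (a y) = y`; then `Prod.snd ∘ h ∘ a` uniformizes `B`.

The set `{g > c}` is the projection of `A ∩ {f > c}`, so `g` is universally measurable. Selecting
from `A ∩ {f > t}` for a universally measurable level `t`, which is possible since universal
completion is idempotent, yields near-optimal selectors, with `t = g^ε` for (i). For (ii), take
`t = min(g, n) - ε` with `ε` a positive function of small integral, pass to an almost everywhere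
equal measurable selector, and let `n → ∞` by monotone convergence.
-/

open Filter Topology
open scoped NNReal

section UniversalCompletion

variable {Ω : Type*} [mΩ : MeasurableSpace Ω]

theorem le_universalCompletion : mΩ ≤ universalCompletion mΩ := fun _ hs =>
  measurableSet_universalCompletion_iff.2 fun _ _ => hs.nullMeasurableSet

theorem nullMeasurableSet_of_measurableSet_universalCompletion {s : Set Ω}
    (hs : MeasurableSet[universalCompletion mΩ] s) (μ : Measure Ω) [SFinite μ] :
    NullMeasurableSet s μ := by
  rcases eq_or_ne μ 0 with rfl | hμ
  · exact NullMeasurableSet.of_null rfl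
  · have : NeZero μ := ⟨hμ⟩
    exact (measurableSet_universalCompletion_iff.1 hs μ.toFinite inferInstance).mono_ac
      (absolutelyContinuous_toFinite μ)

theorem aemeasurable_of_measurable_universalCompletion {β : Type*} [MeasurableSpace β]
    [MeasurableSpace.CountablyGenerated β] {Z : Ω → β} (hZ : Measurable[universalCompletion mΩ] Z)
    (μ : Measure Ω) [SFinite μ] : AEMeasurable Z μ :=
  NullMeasurable.aemeasurable fun _ hs =>
    nullMeasurableSet_of_measurableSet_universalCompletion (hZ hs) μ

theorem measurable_universalCompletion_of_measurable {Y : Type*} [mY : MeasurableSpace Y]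
    {φ : Ω → Y} (hφ : Measurable φ) :
    Measurable[universalCompletion mΩ, universalCompletion mY] φ := by
  intro s hs
  rw [measurableSet_universalCompletion_iff] at hs ⊢
  intro P _
  exact (hs (P.map φ) (Measure.isProbabilityMeasure_map hφ.aemeasurable)).preimage
    ⟨hφ, Measure.AbsolutelyContinuous.rfl⟩

theorem universalCompletion_universalCompletion :
    universalCompletion (universalCompletion mΩ) = universalCompletion mΩ := by
  refine le_antisymm (fun s hs => ?_) (le_universalCompletion (mΩ := universalCompletion mΩ))
  refine measurableSet_universalCompletion_iff.2 fun P hP => ?_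
  have hle : universalCompletion mΩ ≤ (inferInstance : MeasurableSpace (NullMeasurableSpace Ω P)) :=
    fun t ht => measurableSet_universalCompletion_iff.1 ht P hP
  -- `P` extends to a probability measure `Q` on the universal completion.
  let Q : @Measure Ω (universalCompletion mΩ) := P.completion.trim hle
  have hQ : @IsProbabilityMeasure Ω (universalCompletion mΩ) Q :=
    ⟨(trim_measurableSet_eq hle MeasurableSet.univ).trans hP.measure_univ⟩
  obtain ⟨t, ht, hst⟩ :=
    (measurableSet_universalCompletion_iff (mΩ := universalCompletion mΩ)).1 hs Q hQ
  have hst' : s =ᵐ[P] t := ae_eq_of_ae_eq_trim (hm := hle) hst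
  exact NullMeasurableSet.congr (hle t ht) hst'.symm

end UniversalCompletion

section AnalyticSet

theorem nullMeasurableSet_of_forall_lt_exists_subset {α : Type*} [MeasurableSpace α]
    {μ : Measure α} [IsFiniteMeasure μ] {s : Set α}
    (h : ∀ a < μ s, ∃ t ⊆ s, MeasurableSet t ∧ a ≤ μ t) : NullMeasurableSet s μ := by
  rcases eq_or_ne (μ s) 0 with h0 | h0
  · exact NullMeasurableSet.of_null h0
  obtain ⟨a, -, ha, ha_tendsto⟩ := exists_seq_strictMono_tendsto' (pos_iff_ne_zero.2 h0)
  choose t ht_sub ht_meas ht using fun n => h (a n) (ha n).2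
  have hT_meas : MeasurableSet (⋃ n, t n) := MeasurableSet.iUnion ht_meas
  have hT_sub : ⋃ n, t n ⊆ s := iUnion_subset ht_sub
  have hT : μ s ≤ μ (⋃ n, t n) :=
    le_of_tendsto' ha_tendsto fun n => (ht n).trans (measure_mono (subset_iUnion t n))
  have hT_ae : (⋃ n, t n) =ᵐ[μ] toMeasurable μ s :=
    ae_eq_of_subset_of_measure_ge (hT_sub.trans (subset_toMeasurable μ s))
      (by rwa [measure_toMeasurable]) hT_meas.nullMeasurableSet (measure_ne_top _ _)
  refine ⟨⋃ n, t n, hT_meas, EventuallyLE.antisymm ?_ hT_sub.eventuallyLE⟩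
  exact (subset_toMeasurable μ s).eventuallyLE.trans hT_ae.symm.le

theorem exists_lt_measure_image_inter_eval_le {Y : Type*} [MeasurableSpace Y] {μ : Measure Y}
    {u : (ℕ → ℕ) → Y} {a : ℝ≥0∞} {s : Set (ℕ → ℕ)} (hs : a < μ (u '' s)) (n : ℕ) :
    ∃ k, a < μ (u '' (s ∩ {z | z n ≤ k})) := by
  have hmono : Monotone fun k : ℕ => u '' (s ∩ {z | z n ≤ k}) := fun k l hkl =>
    image_mono (inter_subset_inter_right _ fun z (hz : z n ≤ k) => hz.trans hkl)
  have hunion : u '' s = ⋃ k : ℕ, u '' (s ∩ {z | z n ≤ k}) := by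
    rw [← image_iUnion, ← inter_iUnion, inter_eq_left.2]
    exact fun z _ => mem_iUnion.2 ⟨z n, le_refl (z n)⟩
  rw [hunion, hmono.measure_iUnion] at hs
  exact lt_iSup_iff.1 hs

theorem exists_forall_lt_measure_image_pi_Iio {Y : Type*} [MeasurableSpace Y] {μ : Measure Y}
    {u : (ℕ → ℕ) → Y} {a : ℝ≥0∞} (ha : a < μ (range u)) :
    ∃ N : ℕ → ℕ, ∀ n, a < μ (u '' (Iio n).pi fun i => Iic (N i)) := by
  choose! k hk using fun s (hs : a < μ (u '' s)) => exists_lt_measure_image_inter_eval_le hs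
  let S : ℕ → Set (ℕ → ℕ) := fun n => Nat.rec univ (fun n s => s ∩ {z | z n ≤ k s n}) n
  let N : ℕ → ℕ := fun n => k (S n) n
  have hSN : ∀ n, S n = (Iio n).pi fun i => Iic (N i) := by
    intro n
    induction n with
    | zero => simp [S]
    | succ n ih =>
      calc S (n + 1) = S n ∩ {z | z n ≤ N n} := rfl
        _ = (Iio (n + 1)).pi fun i => Iic (N i) := by
          rw [ih]
          ext z
          simp only [mem_inter_iff, Set.mem_pi, mem_Iio, mem_Iic, mem_ofPred_eq,
            Nat.forall_lt_succ_right]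
  refine ⟨N, fun n => ?_⟩
  rw [← hSN]
  induction n with
  | zero => simpa [S] using ha
  | succ n ih => exact hk (S n) ih n

theorem exists_pi_Iio_subset_of_Iic_subset {N : ℕ → ℕ} {U : Set (ℕ → ℕ)} (hU : IsOpen U)
    (h : Iic N ⊆ U) : ∃ n, ((Iio n).pi fun i => Iic (N i)) ⊆ U := by
  let W : ℕ → Set (ℕ → ℕ) := fun n => {z | PiNat.cylinder z n ⊆ U}
  have hW_mono : Monotone W := fun m n hmn z hz => (PiNat.cylinder_anti z hmn).trans hz
  have hW_open : ∀ n, IsOpen (W n) := fun n => isOpen_iff_mem_nhds.2 fun z hz =>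
    mem_of_superset ((PiNat.isOpen_cylinder _ z n).mem_nhds (PiNat.self_mem_cylinder z n))
      fun w hw => (PiNat.mem_cylinder_iff_eq.1 hw).subset.trans hz
  have hW_cover : Iic N ⊆ ⋃ n, W n := fun z hz => by
    obtain ⟨_, ⟨x, n, rfl⟩, hzx, hxU⟩ :=
      (PiNat.isTopologicalBasis_cylinders fun _ : ℕ => ℕ).exists_subset_of_mem_open (h hz) hU
    exact mem_iUnion.2 ⟨n, (PiNat.mem_cylinder_iff_eq.1 hzx).subset.trans hxU⟩
  have hN : IsCompact (Iic N) := Icc_bot (a := N) ▸ isCompact_Icc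
  obtain ⟨n, hn⟩ := hN.elim_directed_cover W hW_open hW_cover hW_mono.directed_le
  refine ⟨n, fun z hz => ?_⟩
  have hzN : z ⊓ N ∈ W n := hn (mem_Iic.2 inf_le_right)
  exact hzN fun i hi => (min_eq_left (hz i hi)).symm

theorem exists_isCompact_subset_range_le_measure {Y : Type*} [TopologicalSpace Y]
    [MeasurableSpace Y] {μ : Measure Y} [μ.OuterRegular] {u : (ℕ → ℕ) → Y} (hu : Continuous u)
    {a : ℝ≥0∞} (ha : a < μ (range u)) : ∃ K ⊆ range u, IsCompact K ∧ a ≤ μ K := by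
  obtain ⟨N, hN⟩ := exists_forall_lt_measure_image_pi_Iio ha
  have hN_compact : IsCompact (Iic N) := Icc_bot (a := N) ▸ isCompact_Icc
  refine ⟨u '' Iic N, image_subset_range _ _, hN_compact.image hu, ?_⟩
  rw [Set.measure_eq_iInf_isOpen]
  refine le_iInf₂ fun V hV => le_iInf fun hV_open => ?_
  obtain ⟨n, hn⟩ :=
    exists_pi_Iio_subset_of_Iic_subset (hV_open.preimage hu) (image_subset_iff.1 hV)
  exact (hN n).le.trans (measure_mono (image_subset_iff.2 hn))

theorem nullMeasurableSet_of_analyticSet {Y : Type*} [TopologicalSpace Y] [T2Space Y]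
    [MeasurableSpace Y] [OpensMeasurableSpace Y] {s : Set Y} (hs : AnalyticSet s) (μ : Measure Y)
    [IsFiniteMeasure μ] [μ.OuterRegular] : NullMeasurableSet s μ := by
  rw [AnalyticSet] at hs
  obtain rfl | ⟨u, hu, rfl⟩ := hs
  · exact nullMeasurableSet_empty
  · refine nullMeasurableSet_of_forall_lt_exists_subset fun a ha => ?_
    obtain ⟨K, hKu, hK, haK⟩ := exists_isCompact_subset_range_le_measure hu ha
    exact ⟨K, hKu, hK.measurableSet, haK⟩

theorem measurableSet_universalCompletion_of_analyticSet {Y : Type*} [TopologicalSpace Y]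
    [TopologicalSpace.MetrizableSpace Y] [mY : MeasurableSpace Y] [BorelSpace Y] {s : Set Y}
    (hs : AnalyticSet s) : MeasurableSet[universalCompletion mY] s :=
  measurableSet_universalCompletion_iff.2 fun P _ => nullMeasurableSet_of_analyticSet hs P

end AnalyticSet

section Uniformization

theorem exists_measurable_nat_mem_of_mem_iUnion {Y : Type*} [MeasurableSpace Y] {T : ℕ → Set Y}
    (hT : ∀ k, MeasurableSet (T k)) :
    ∃ κ : Y → ℕ, Measurable κ ∧ ∀ y ∈ ⋃ k, T k, y ∈ T (κ y) := by
  classical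
  have hex : ∀ y, ∃ k, y ∈ T k ∪ (⋃ j, T j)ᶜ := fun y => by
    by_cases hy : y ∈ ⋃ j, T j
    · exact (mem_iUnion.1 hy).imp fun _ => Or.inl
    · exact ⟨0, Or.inr hy⟩
  refine ⟨fun y => Nat.find (hex y),
    measurable_find hex fun k => (hT k).union (MeasurableSet.iUnion hT).compl, fun y hy => ?_⟩
  exact (Nat.find_spec (hex y)).resolve_right (not_not_intro hy)

theorem exists_measurable_branch {Y : Type*} [MeasurableSpace Y] {T : List ℕ → Set Y}
    (hT : ∀ l, MeasurableSet (T l)) (hT_sub : ∀ l, T l ⊆ ⋃ k, T (k :: l)) :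
    ∃ a : Y → ℕ → ℕ, Measurable a ∧ ∀ y ∈ T [], ∀ n, y ∈ T (PiNat.res (a y) n) := by
  choose κ hκ hκT using fun l => exists_measurable_nat_mem_of_mem_iUnion fun k => hT (k :: l)
  let F : ℕ → Y → List ℕ := fun n y => Nat.rec [] (fun _ l => κ l y :: l) n
  let a : Y → ℕ → ℕ := fun y n => κ (F n y) y
  have hF : ∀ y n, PiNat.res (a y) n = F n y := fun y n => by
    induction n with
    | zero => rfl
    | succ n ih => rw [PiNat.res_succ, ih]
  let _ : MeasurableSpace (List ℕ) := ⊤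
  have hκF : ∀ {n}, Measurable (F n) → Measurable fun y => κ (F n y) y := fun hn =>
    (measurable_from_prod_countable_right (f := fun p : List ℕ × Y => κ p.1 p.2) hκ).comp
      (hn.prodMk measurable_id)
  have hF_meas : ∀ n, Measurable (F n) := fun n => by
    induction n with
    | zero => exact measurable_const
    | succ n ih =>
      exact (measurable_of_countable fun p : ℕ × List ℕ => p.1 :: p.2).comp ((hκF ih).prodMk ih)
  refine ⟨a, measurable_pi_lambda _ fun n => hκF (hF_meas n), fun y hy n => ?_⟩
  rw [hF]
  induction n with
  | zero => exact hy
  | succ n ih => exact hκT _ y (hT_sub _ ih)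

theorem isOpen_setOf_res_length_eq {α : Type*} [TopologicalSpace α] [DiscreteTopology α]
    (l : List α) : IsOpen {z : ℕ → α | PiNat.res z l.length = l} :=
  isOpen_iff_mem_nhds.2 fun z hz =>
    mem_of_superset ((PiNat.isOpen_cylinder _ z l.length).mem_nhds (PiNat.self_mem_cylinder z _))
      fun w hw => by
        rw [PiNat.cylinder_eq_res] at hw
        exact hw.trans hz

theorem image_setOf_res_eq_subset_iUnion {α Y : Type*} (u : (ℕ → α) → Y) (l : List α) :
    u '' {z | PiNat.res z l.length = l} ⊆
      ⋃ k, u '' {z | PiNat.res z (k :: l).length = k :: l} := by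
  rintro _ ⟨z, hz, rfl⟩
  exact mem_iUnion.2 ⟨z l.length, z, congrArg (z l.length :: ·) hz, rfl⟩

theorem tendsto_of_forall_res_eq {α : Type*} [TopologicalSpace α] {z : ℕ → ℕ → α} {a : ℕ → α}
    (h : ∀ n, PiNat.res (z n) n = PiNat.res a n) : Tendsto z atTop (𝓝 a) := by
  refine tendsto_pi_nhds.2 fun i => tendsto_const_nhds.congr' ?_
  filter_upwards [eventually_gt_atTop i] with n hn using (PiNat.res_eq_res.1 (h n) hn).symm

theorem exists_measurable_rightInverse_on_range {Y : Type*} [TopologicalSpace Y] [T1Space Y]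
    [MeasurableSpace Y] {u : (ℕ → ℕ) → Y} (hu : Continuous u)
    (hm : ∀ l : List ℕ, MeasurableSet (u '' {z | PiNat.res z l.length = l})) :
    ∃ a : Y → ℕ → ℕ, Measurable a ∧ ∀ y ∈ range u, u (a y) = y := by
  obtain ⟨a, ha, haT⟩ := exists_measurable_branch hm (image_setOf_res_eq_subset_iUnion u)
  refine ⟨a, ha, fun y hy => ?_⟩
  have hy_root : y ∈ u '' {z | PiNat.res z 0 = []} := by simpa using hy
  choose z hz hzy using haT y hy_root
  have hz_tendsto : Tendsto z atTop (𝓝 (a y)) :=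
    tendsto_of_forall_res_eq fun n => by simpa only [mem_ofPred_eq, PiNat.res_length] using hz n
  have hu_tendsto : Tendsto (fun n => u (z n)) atTop (𝓝 (u (a y))) :=
    (hu.tendsto _).comp hz_tendsto
  simp only [hzy] at hu_tendsto
  exact (tendsto_const_nhds_iff.1 hu_tendsto).symm

theorem projΩ_eq_image_fst {Ω E : Type*} (A : Set (Ω × E)) : projΩ A = Prod.fst '' A := by
  ext ω
  simp [projΩ]

/-- The **Jankov–von Neumann uniformization theorem**. -/
theorem exists_measurable_uniformization {Y E : Type*} [TopologicalSpace Y]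
    [TopologicalSpace.MetrizableSpace Y] [mY : MeasurableSpace Y] [BorelSpace Y]
    [TopologicalSpace E] [MeasurableSpace E] [BorelSpace E] [Nonempty E] {B : Set (Y × E)}
    (hB : AnalyticSet B) :
    ∃ Z : Y → E, Measurable[universalCompletion mY] Z ∧ ∀ y ∈ projΩ B, (y, Z y) ∈ B := by
  rw [AnalyticSet] at hB
  obtain rfl | ⟨h, hh, rfl⟩ := hB
  · inhabit E
    exact ⟨fun _ => default, measurable_const, by simp [projΩ]⟩
  have hu : Continuous fun z => (h z).1 := continuous_fst.comp hh
  obtain ⟨a, ha, hau⟩ := @exists_measurable_rightInverse_on_range _ _ _ (universalCompletion _) _ hu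
    fun l => measurableSet_universalCompletion_of_analyticSet
      ((isOpen_setOf_res_length_eq l).analyticSet_image hu)
  refine ⟨fun y => (h (a y)).2, (continuous_snd.comp hh).measurable.comp ha, fun y hy => ?_⟩
  rw [projΩ_eq_image_fst, ← range_comp] at hy
  exact ⟨a y, Prod.ext (hau y hy) rfl⟩

end Uniformization

section Selection

theorem exists_eq_preimage_prodMap {Ω E : Type*} [MeasurableSpace Ω] [MeasurableSpace E]
    {A : Set (Ω × E)} (hA : MeasurableSet A) :
    ∃ (φ : Ω → ℕ → ℕ) (B : Set ((ℕ → ℕ) × E)), Measurable φ ∧ MeasurableSet B ∧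
      A = Prod.map φ id ⁻¹' B := by
  classical
  induction A, hA using
    MeasurableSpace.induction_on_inter generateFrom_prod.symm isPiSystem_prod with
  | empty => exact ⟨fun _ _ => 0, ∅, measurable_const, MeasurableSet.empty, rfl⟩
  | basic t ht =>
    obtain ⟨s, hs, r, hr, rfl⟩ := ht
    refine ⟨fun ω _ => if ω ∈ s then 1 else 0, {y | y 0 = 1} ×ˢ r, ?_, ?_, ?_⟩
    · exact measurable_pi_lambda _ fun _ => Measurable.ite hs measurable_const measurable_const
    · exact (measurableSet_eq_fun (measurable_pi_apply 0) measurable_const).prod hr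
    · ext ⟨ω, x⟩
      simp
  | compl t _ ih =>
    obtain ⟨φ, B, hφ, hB, rfl⟩ := ih
    exact ⟨φ, Bᶜ, hφ, hB.compl, rfl⟩
  | iUnion t _ _ ih =>
    choose φ B hφ hB ht using ih
    let unpair : ℕ → (ℕ → ℕ) → ℕ → ℕ := fun n y j => y (Nat.pair n j)
    have hunpair : ∀ n, Measurable (unpair n) := fun n =>
      measurable_pi_lambda _ fun j => measurable_pi_apply _
    refine ⟨fun ω k => φ k.unpair.1 ω k.unpair.2, ⋃ n, Prod.map (unpair n) id ⁻¹' B n, ?_, ?_, ?_⟩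
    · exact measurable_pi_lambda _ fun k => (measurable_pi_apply _).comp (hφ _)
    · exact MeasurableSet.iUnion fun n => (hunpair n).prodMap measurable_id (hB n)
    · ext ⟨ω, x⟩
      simp [ht, unpair]

variable {Ω : Type u} [mΩ : MeasurableSpace Ω] {E : Type v} [MeasurableSpace E]
  [StandardBorelSpace E]

theorem measurableSet_projΩ {A : Set (Ω × E)} (hA : MeasurableSet A) :
    MeasurableSet[universalCompletion mΩ] (projΩ A) := by
  obtain ⟨φ, B, hφ, hB, rfl⟩ := exists_eq_preimage_prodMap hA
  let _ := upgradeStandardBorel E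
  have hB_proj : AnalyticSet (projΩ B) := by
    rw [projΩ_eq_image_fst]
    exact hB.analyticSet.image_of_continuous continuous_fst
  exact measurable_universalCompletion_of_measurable hφ
    (measurableSet_universalCompletion_of_analyticSet hB_proj)

theorem exists_measurable_selector [Nonempty E] {A : Set (Ω × E)} (hA : MeasurableSet A) :
    ∃ Z : Ω → E, Measurable[universalCompletion mΩ] Z ∧ ∀ ω ∈ projΩ A, (ω, Z ω) ∈ A := by
  obtain ⟨φ, B, hφ, hB, rfl⟩ := exists_eq_preimage_prodMap hA
  let _ := upgradeStandardBorel E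
  obtain ⟨Z, hZ, hZB⟩ := exists_measurable_uniformization hB.analyticSet
  exact ⟨Z ∘ φ, hZ.comp (measurable_universalCompletion_of_measurable hφ), fun ω => hZB (φ ω)⟩

end Selection

section BorelSpace

theorem standardBorelSpace_of_measurableEquiv {α β : Type*} [MeasurableSpace α]
    [MeasurableSpace β] [StandardBorelSpace β] (e : α ≃ᵐ β) : StandardBorelSpace α := by
  obtain ⟨_, hβ, _⟩ := StandardBorelSpace.polish (α := β)
  let _ : TopologicalSpace α := TopologicalSpace.induced e inferInstance
  have : PolishSpace α := e.toEquiv.polishSpace_induced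
  have : BorelSpace α := ⟨by rw [borel_comap, ← hβ.measurable_eq, e.measurableEmbedding.comap_eq]⟩
  infer_instance

theorem IsBorelTopSpace.standardBorelSpace {E : Type v} [TopologicalSpace E] [MeasurableSpace E]
    [BorelSpace E] (hE : IsBorelTopSpace E) : StandardBorelSpace E := by
  obtain ⟨X, _, _, s, hs, ⟨e⟩⟩ := hE
  borelize X
  have := hs.standardBorel
  exact standardBorelSpace_of_measurableEquiv e.toMeasurableEquiv

end BorelSpace

section OptimalSelection

variable {Ω : Type u} {E : Type v} {A : Set (Ω × E)} {f : Ω × E → EReal}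

theorem lt_supFun_iff {c : EReal} {ω : Ω} :
    c < supFun A f ω ↔ ∃ x, (ω, x) ∈ A ∧ c < f (ω, x) := by
  simp only [supFun, lt_sSup_iff, mem_ofPred_eq]
  grind

theorem le_supFun (f : Ω × E → EReal) {ω : Ω} {x : E} (h : (ω, x) ∈ A) :
    f (ω, x) ≤ supFun A f ω :=
  le_sSup ⟨x, h, rfl⟩

theorem supFunEps_lt_supFun {ε : ℝ} (hε : 0 < ε) {ω : Ω} (h : supFun A f ω ≠ ⊥) :
    supFunEps A f ε ω < supFun A f ω := by
  unfold supFunEps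
  split_ifs with ht
  · rw [ht]
    exact EReal.coe_lt_top _
  · lift supFun A f ω to ℝ using ⟨ht, h⟩ with r
    exact_mod_cast sub_lt_self r hε

variable [mΩ : MeasurableSpace Ω] [MeasurableSpace E] [StandardBorelSpace E]

theorem measurable_supFun (hA : MeasurableSet A) (hf : Measurable f) :
    Measurable[universalCompletion mΩ] (supFun A f) := by
  refine @measurable_of_Ioi _ _ _ _ _ (universalCompletion mΩ) _ _ _ _ fun c => ?_
  have hc : supFun A f ⁻¹' Ioi c = projΩ (A ∩ f ⁻¹' Ioi c) := by
    ext ω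
    exact lt_supFun_iff
  rw [hc]
  exact measurableSet_projΩ (hA.inter (hf measurableSet_Ioi))

theorem measurable_supFunEps (hA : MeasurableSet A) (hf : Measurable f) (ε : ℝ) :
    Measurable[universalCompletion mΩ] (supFunEps A f ε) := by
  classical
  have hlevel : Measurable fun y : EReal => if y = ⊤ then ((1 / ε : ℝ) : EReal) else y - ε :=
    Measurable.ite (measurableSet_singleton ⊤) measurable_const (by fun_prop)
  convert! hlevel.comp (measurable_supFun hA hf) using 1

variable [Nonempty E]

theorem exists_measurable_selector_lt (hA : MeasurableSet A) (hf : Measurable f) {t : Ω → EReal}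
    (ht : Measurable[universalCompletion mΩ] t) :
    ∃ Z : Ω → E, Measurable[universalCompletion mΩ] Z ∧
      ∀ ω ∈ projΩ A, (ω, Z ω) ∈ A ∧ (t ω < supFun A f ω → t ω < f (ω, Z ω)) := by
  classical
  let A' : Set (Ω × E) := A ∩ {p | t p.1 < f p}
  -- `A'` is only measurable when `Ω` carries the universal completion, hence the idempotence.
  have hle : mΩ.prod ‹_› ≤ (universalCompletion mΩ).prod ‹MeasurableSpace E› :=
    sup_le_sup_right (MeasurableSpace.comap_mono le_universalCompletion) _
  have hA' : MeasurableSet[(universalCompletion mΩ).prod ‹_›] A' :=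
    (hle _ hA).inter (measurableSet_lt (ht.comp measurable_fst) (hf.mono hle le_rfl))
  have hA'_proj := measurableSet_projΩ (mΩ := universalCompletion mΩ) hA'
  obtain ⟨Z', hZ', hZ'A⟩ := exists_measurable_selector (mΩ := universalCompletion mΩ) hA'
  rw [universalCompletion_universalCompletion] at hA'_proj hZ'
  obtain ⟨Z, hZ, hZA⟩ := exists_measurable_selector hA
  refine ⟨(projΩ A').piecewise Z' Z, hZ'.piecewise hA'_proj hZ, fun ω hω => ?_⟩
  by_cases hω' : ω ∈ projΩ A'
  · rw [piecewise_eq_of_mem _ _ _ hω']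
    exact ⟨(hZ'A ω hω').1, fun _ => (hZ'A ω hω').2⟩
  · rw [piecewise_eq_of_notMem _ _ _ hω']
    exact ⟨hZA ω hω, fun hlt => absurd (lt_supFun_iff.1 hlt) hω'⟩

theorem exists_measurable_selector_supFunEps_le (hA : MeasurableSet A) (hf : Measurable f) {ε : ℝ}
    (hε : 0 < ε) : ∃ Z : Ω → E, Measurable[universalCompletion mΩ] Z ∧
      ∀ ω ∈ projΩ A, (ω, Z ω) ∈ A ∧ supFunEps A f ε ω ≤ f (ω, Z ω) := by
  obtain ⟨Z, hZ, hZA⟩ := exists_measurable_selector_lt hA hf (measurable_supFunEps hA hf ε)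
  refine ⟨Z, hZ, fun ω hω => ⟨(hZA ω hω).1, ?_⟩⟩
  rcases eq_or_ne (supFun A f ω) ⊥ with hbot | hbot
  · simp [supFunEps, hbot]
  · exact ((hZA ω hω).2 (supFunEps_lt_supFun hε hbot)).le

theorem exists_measurable_selector_min_supFun_le (hA : MeasurableSet A) (hf : Measurable f) (r : ℝ)
    {ε : Ω → ℝ≥0} (hε : Measurable ε) (hε_pos : ∀ ω, 0 < ε ω) :
    ∃ Z : Ω → E, Measurable[universalCompletion mΩ] Z ∧
      ∀ ω ∈ projΩ A, (ω, Z ω) ∈ A ∧ min (supFun A f ω) r ≤ f (ω, Z ω) + (ε ω : ℝ) := by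
  let t : Ω → EReal := fun ω => min (supFun A f ω) r - (ε ω : ℝ)
  have ht : Measurable[universalCompletion mΩ] t :=
    ((measurable_supFun hA hf).min measurable_const).sub
      (hε.mono le_universalCompletion le_rfl).coe_nnreal_real.coe_real_ereal
  obtain ⟨Z, hZ, hZA⟩ := exists_measurable_selector_lt hA hf ht
  refine ⟨Z, hZ, fun ω hω => ⟨(hZA ω hω).1, ?_⟩⟩
  rcases eq_or_ne (supFun A f ω) ⊥ with hbot | hbot
  · simp [hbot]
  have ht_lt : t ω < supFun A f ω := by
    refine lt_of_lt_of_le ?_ (min_le_left _ (r : EReal))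
    have hmin_top : min (supFun A f ω) (r : EReal) ≠ ⊤ := by simp
    have hmin_bot : min (supFun A f ω) (r : EReal) ≠ ⊥ := by simp [hbot]
    simp only [t]
    lift min (supFun A f ω) (r : EReal) to ℝ using ⟨hmin_top, hmin_bot⟩ with s
    exact_mod_cast sub_lt_self s (NNReal.coe_pos.2 (hε_pos ω))
  exact (EReal.sub_le_iff_le_add (.inl (EReal.coe_ne_bot _)) (.inl (EReal.coe_ne_top _))).1
    ((hZA ω hω).2 ht_lt).le

end OptimalSelection

section Expectation

theorem ereal_le_of_forall_pos_le_add {a b : EReal} (h : ∀ δ : ℝ, 0 < δ → a ≤ b + δ) : a ≤ b := by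
  refine EReal.le_of_forall_lt_iff_le.1 fun z hz => ?_
  induction b with
  | bot => exact (h 1 one_pos).trans (by simp)
  | coe b =>
    have hδ := h (z - b) (sub_pos.2 (EReal.coe_lt_coe_iff.1 hz))
    rwa [← EReal.coe_add, add_sub_cancel] at hδ
  | top => exact absurd hz not_top_lt

variable {Ω : Type*} [MeasurableSpace Ω] {P : Measure Ω} {X Y : Ω → EReal}

theorem extExpectation_mono_ae (h : X ≤ᵐ[P] Y) : extExpectation P X ≤ extExpectation P Y := by
  refine EReal.sub_le_sub (EReal.coe_ennreal_le_coe_ennreal_iff.2 (lintegral_mono_ae ?_))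
    (EReal.coe_ennreal_le_coe_ennreal_iff.2 (lintegral_mono_ae ?_))
  · filter_upwards [h] with ω hω using EReal.toENNReal_le_toENNReal hω
  · filter_upwards [h] with ω hω using EReal.toENNReal_le_toENNReal (EReal.neg_le_neg_iff.2 hω)

theorem tendsto_extExpectation_min_natCast (hX : AEMeasurable X P) :
    Tendsto (fun n : ℕ => extExpectation P fun ω => min (X ω) n) atTop
      (𝓝 (extExpectation P X)) := by
  have hpos : ∀ (x : EReal) (n : ℕ), (min x n).toENNReal = min x.toENNReal n := fun x n => by
    rw [Monotone.map_min fun _ _ => EReal.toENNReal_le_toENNReal, ← EReal.coe_coe_eq_natCast,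
      EReal.real_coe_toENNReal, ENNReal.ofReal_natCast]
  have hneg : ∀ (x : EReal) (n : ℕ), (-min x n).toENNReal = (-x).toENNReal := fun x n => by
    rcases le_total x n with hxn | hxn
    · rw [min_eq_left hxn]
    · have hx0 : 0 ≤ x := (Nat.cast_nonneg' n).trans hxn
      rw [EReal.toENNReal_of_nonpos, EReal.toENNReal_of_nonpos] <;> simp [hx0]
  simp only [extExpectation, hpos, hneg]
  have htendsto : Tendsto (fun n : ℕ => ∫⁻ ω, min (X ω).toENNReal n ∂P) atTop
      (𝓝 (∫⁻ ω, (X ω).toENNReal ∂P)) := by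
    refine lintegral_tendsto_of_tendsto_of_monotone
      (fun n => hX.ereal_toENNReal.min aemeasurable_const) ?_ ?_ <;> refine ae_of_all _ fun ω => ?_
    · exact fun m n hmn => min_le_min_left _ (Nat.cast_le.2 hmn)
    · simpa using (tendsto_const_nhds (x := (X ω).toENNReal)).min ENNReal.tendsto_nat_nhds_top
  rcases eq_or_ne (∫⁻ ω, (-X ω).toENNReal ∂P) ∞ with hneg_top | hneg_top
  · simp [hneg_top]
  · simp only [sub_eq_add_neg]
    exact (EReal.continuousAt_add (.inr (by simpa using hneg_top)) (.inl (by simp))).tendsto.comp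
      (((continuous_coe_ennreal_ereal.tendsto _).comp htendsto).prodMk_nhds tendsto_const_nhds)

theorem coe_sub_coe_le_of_le_add {a b c d η : ℝ≥0∞} (hη : η ≠ ∞) (hac : a ≤ c + η)
    (hdb : d ≤ b + η) : (a : EReal) - b ≤ c - d + ((2 * η : ℝ≥0∞) : EReal) := by
  rcases eq_or_ne b ∞ with rfl | hb
  · simp
  have hd : d ≠ ∞ := ne_top_of_le_ne_top (ENNReal.add_ne_top.2 ⟨hb, hη⟩) hdb
  refine EReal.sub_le_of_le_add ?_
  calc (a : EReal) ≤ (c + η : ℝ≥0∞) := EReal.coe_ennreal_le_coe_ennreal_iff.2 hac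
    _ = c - d + ((d + η : ℝ≥0∞) : EReal) := by
      lift d to ℝ≥0 using hd
      rw [EReal.coe_ennreal_add, EReal.coe_ennreal_add, ← add_assoc]
      congr 1
      exact EReal.sub_add_cancel.symm
    _ ≤ c - d + ((2 * η + b : ℝ≥0∞) : EReal) := by
      gcongr
      exact EReal.coe_ennreal_le_coe_ennreal_iff.2
        (by rw [two_mul, add_right_comm, add_comm η b]; gcongr)
    _ = c - d + ((2 * η : ℝ≥0∞) : EReal) + b := by rw [EReal.coe_ennreal_add, add_assoc]

theorem extExpectation_le_add_of_le_add {ε : Ω → ℝ≥0} (hε : AEMeasurable ε P)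
    (hε_fin : ∫⁻ ω, ε ω ∂P ≠ ∞) (h : ∀ᵐ ω ∂P, X ω ≤ Y ω + (ε ω : ℝ)) :
    extExpectation P X ≤ extExpectation P Y + ((2 * ∫⁻ ω, ε ω ∂P : ℝ≥0∞) : EReal) := by
  set η := ∫⁻ ω, ε ω ∂P
  have hpos : ∫⁻ ω, (X ω).toENNReal ∂P ≤ ∫⁻ ω, (Y ω).toENNReal ∂P + η := by
    rw [← lintegral_add_right' _ hε.coe_nnreal_ennreal]
    refine lintegral_mono_ae ?_
    filter_upwards [h] with ω hω
    exact (EReal.toENNReal_le_toENNReal hω).trans (EReal.toENNReal_add_le.trans_eq (by simp))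
  have hneg : ∫⁻ ω, (-Y ω).toENNReal ∂P ≤ ∫⁻ ω, (-X ω).toENNReal ∂P + η := by
    rw [← lintegral_add_right' _ hε.coe_nnreal_ennreal]
    refine lintegral_mono_ae ?_
    filter_upwards [h] with ω hω
    have hω' : -Y ω ≤ -X ω + (ε ω : ℝ) := by
      rw [← EReal.neg_sub (.inr (EReal.coe_ne_bot _)) (.inr (EReal.coe_ne_top _)),
        EReal.neg_le_neg_iff]
      exact EReal.sub_le_of_le_add hω
    exact (EReal.toENNReal_le_toENNReal hω').trans (EReal.toENNReal_add_le.trans_eq (by simp))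
  exact coe_sub_coe_le_of_le_add hε_fin hpos hneg

theorem extExpectation_le_of_forall_exists [SigmaFinite P] {S : EReal}
    (h : ∀ ε : Ω → ℝ≥0, Measurable ε → (∀ ω, 0 < ε ω) →
      ∃ Y : Ω → EReal, extExpectation P Y ≤ S ∧ ∀ᵐ ω ∂P, X ω ≤ Y ω + (ε ω : ℝ)) :
    extExpectation P X ≤ S := by
  refine ereal_le_of_forall_pos_le_add fun δ hδ => ?_
  obtain ⟨ε, hε_pos, hε, hε_lt⟩ :=
    exists_pos_lintegral_lt_of_sigmaFinite P (ENNReal.ofReal_pos.2 (half_pos hδ)).ne'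
  obtain ⟨Y, hYS, hXY⟩ := h ε hε hε_pos
  have hε_le : 2 * ∫⁻ ω, ε ω ∂P ≤ ENNReal.ofReal δ := by
    rw [← mul_div_cancel₀ δ two_ne_zero, ENNReal.ofReal_mul two_pos.le]
    simpa using mul_le_mul_right hε_lt.le 2
  calc extExpectation P X
      ≤ extExpectation P Y + ((2 * ∫⁻ ω, ε ω ∂P : ℝ≥0∞) : EReal) :=
        extExpectation_le_add_of_le_add hε.aemeasurable hε_lt.ne_top hXY
    _ ≤ S + ((ENNReal.ofReal δ : ℝ≥0∞) : EReal) :=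
        add_le_add hYS (EReal.coe_ennreal_le_coe_ennreal_iff.2 hε_le)
    _ = S + δ := by rw [EReal.coe_ennreal_ofReal, max_eq_left hδ.le]

variable {E : Type*} [MeasurableSpace E] [StandardBorelSpace E] [Nonempty E] {A : Set (Ω × E)}
  {f : Ω × E → EReal}

theorem extExpectation_indicator_supFun (hA : MeasurableSet A) (hf : Measurable f) (P : Measure Ω)
    [SigmaFinite P] :
    extExpectation P ((projΩ A).indicator (supFun A f)) =
      sSup {e : EReal | ∃ Z : Ω → E, Measurable Z ∧
        (∀ᵐ ω ∂P, ω ∈ projΩ A → (ω, Z ω) ∈ A) ∧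
        e = extExpectation P ((projΩ A).indicator fun ω => f (ω, Z ω))} := by
  apply le_antisymm
  · have hg : AEMeasurable ((projΩ A).indicator (supFun A f)) P :=
      (aemeasurable_of_measurable_universalCompletion (measurable_supFun hA hf) P).indicator₀
        (nullMeasurableSet_of_measurableSet_universalCompletion (measurableSet_projΩ hA) P)
    refine le_of_tendsto' (tendsto_extExpectation_min_natCast hg) fun n =>
      extExpectation_le_of_forall_exists fun ε hε hε_pos => ?_
    obtain ⟨Z, hZ, hZA⟩ := exists_measurable_selector_min_supFun_le hA hf n hε hε_pos
    have hZ_ae : AEMeasurable Z P := aemeasurable_of_measurable_universalCompletion hZ P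
    refine ⟨(projΩ A).indicator fun ω => f (ω, hZ_ae.mk Z ω),
      le_sSup ⟨hZ_ae.mk Z, hZ_ae.measurable_mk, ?_, rfl⟩, ?_⟩
    · filter_upwards [hZ_ae.ae_eq_mk] with ω hω hωA using hω ▸ (hZA ω hωA).1
    · filter_upwards [hZ_ae.ae_eq_mk] with ω hω
      by_cases hωA : ω ∈ projΩ A
      · simpa [hωA, ← hω] using (hZA ω hωA).2
      · simp [hωA]
  · refine sSup_le ?_
    rintro _ ⟨Z, -, hZA, rfl⟩
    refine extExpectation_mono_ae ?_
    filter_upwards [hZA] with ω hω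
    exact indicator_le_indicator' fun hωA => le_supFun f (hω hωA)

end Expectation

theorem mainTheorem7_general {Ω : Type u} [mΩ : MeasurableSpace Ω]
    {E : Type v} [MeasurableSpace E] [StandardBorelSpace E] [Nonempty E]
    (A : Set (Ω × E)) (hA : MeasurableSet A)
    (f : Ω × E → EReal) (hf : Measurable f) :
    (Measurable[universalCompletion mΩ] (supFun A f) ∧
      MeasurableSet[universalCompletion mΩ] (projΩ A) ∧
      ∀ ε : ℝ, 0 < ε → ∃ Z : Ω → E, Measurable[universalCompletion mΩ] Z ∧
        ∀ ω ∈ projΩ A, (ω, Z ω) ∈ A ∧ supFunEps A f ε ω ≤ f (ω, Z ω)) ∧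
    ∀ P : Measure Ω, SigmaFinite P →
      extExpectation P ((projΩ A).indicator (supFun A f)) =
        sSup {e : EReal | ∃ Z : Ω → E, Measurable Z ∧
          (∀ᵐ ω ∂P, ω ∈ projΩ A → (ω, Z ω) ∈ A) ∧
          e = extExpectation P ((projΩ A).indicator fun ω => f (ω, Z ω))} :=
  ⟨⟨measurable_supFun hA hf, measurableSet_projΩ hA,
    fun _ hε => exists_measurable_selector_supFunEps_le hA hf hε⟩,
    fun P _ => extExpectation_indicator_supFun hA hf P⟩

theorem mainTheorem7 {Ω : Type u} [mΩ : MeasurableSpace Ω]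
    {E : Type v} [TopologicalSpace E] [MeasurableSpace E] [BorelSpace E] [Nonempty E]
    (hE : IsBorelTopSpace E)
    (A : Set (Ω × E)) (hA : MeasurableSet A)
    (f : Ω × E → EReal) (hf : Measurable f) :
    (Measurable[universalCompletion mΩ] (supFun A f) ∧
      MeasurableSet[universalCompletion mΩ] (projΩ A) ∧
      ∀ ε : ℝ, 0 < ε → ∃ Z : Ω → E, Measurable[universalCompletion mΩ] Z ∧
        ∀ ω ∈ projΩ A, (ω, Z ω) ∈ A ∧ supFunEps A f ε ω ≤ f (ω, Z ω)) ∧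
    ∀ P : Measure Ω, IsProbabilityMeasure P →
      extExpectation P ((projΩ A).indicator (supFun A f)) =
        sSup {e : EReal | ∃ Z : Ω → E, Measurable Z ∧
          (∀ᵐ ω ∂P, ω ∈ projΩ A → (ω, Z ω) ∈ A) ∧
          e = extExpectation P ((projΩ A).indicator fun ω => f (ω, Z ω))} := by
  have := hE.standardBorelSpace
  exact (mainTheorem7_general A hA f hf).imp_right fun h P _ => h P inferInstance
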